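/- Let $\Omega:\mathbb R\to[0,\infty)$ be a Young function (convex, left-continuous, even, $\Omega(0)=0$, $\Omega(x)\to\infty$ as $x\to\infty$) satisfying the Mulholland condition: $\Omega$ is continuous, strictly increasing on $[0,\infty)$, and $\log\Omega(x)$ is a convex function of $\log x$ for $x>0$. Write $\Omega(x)=|x|e^{\chi(\ln|x|)}$, where $\chi:\mathbb R\to\mathbb R$ is the characteristic function of $\Omega$, and suppose that for some $1\le p<\infty$ the line $\chi_p(s)=(p-1)s-\ln p$ is an asymptote of $\chi$, i.e. $\chi(s)-\chi_p(s)\to0$ as $s\to+\infty$. Let $q\in[1,\infty]$ with $\frac1p+\frac1q=1$. Let $X_1,X_2$ be (real or complex) Banach spaces, and equip $X_1\oplus X_2$ with the $F$-norm and metric $$\|(x_1,x_2)\|_\Omega=\Omega^{-1}\big(\Omega(\|x_1\|)+\Omega(\|x_2\|)\big),\qquad d_\Omega(x,y)=\|x-y\|_\Omega,$$ where $\Omega^{-1}$ is the inverse of the bijection $\Omega:[0,\infty)\to[0,\infty)$. Then the dual of the $F$-space $(X_1\oplus X_2,d_\Omega)$, that is, the space of its continuous linear functionals, is the Banach space $(X_1^*\oplus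 X_2^*,\|\cdot\|_q)$, where $\|(f_1,f_2)\|_q=(\|f_1\|^q+\|f_2\|^q)^{1/q}$ for $q<\infty$ and $\|(f_1,f_2)\|_\infty=\max(\|f_1\|,\|f_2\|)$. More precisely, the map $T$ given by $T(f_1,f_2)(x_1,x_2)=f_1(x_1)+f_2(x_2)$ is a linear bijection of $X_1^*\oplus X_2^*$ onto the dual; it is a homeomorphism when $X_1^*\oplus X_2^*$ carries the norm $\|\cdot\|_q$ and the dual carries the strong topology (uniform convergence on bounded sets); and it is isometric for the dual norm induced by the $F$-norm: for all $(f_1,f_2)$, $$\|(f_1,f_2)\|_q=\min\big\{C\ge0:\ |T(f_1,f_2)(x)|\le C\,\|x\|_\Omega\ \text{ for all }x\in X_1\oplus X_2\big\}.$$ -/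

import Mathlib

open Filter Topology

/-- A (finite) Young function: a convex, left-continuous, even function `Φ : ℝ → [0, ∞)` with
`Φ 0 = 0` and `Φ x → ∞` as `x → ∞`. Young functions with the Mulholland condition below are
finite, so real values suffice. -/
structure IsYoungFunction (Φ : ℝ → ℝ) : Prop where
  nonneg : ∀ x, 0 ≤ Φ x
  convex : ConvexOn ℝ Set.univ Φ
  left_continuous : ∀ x, ContinuousWithinAt Φ (Set.Iic x) x
  even : ∀ x, Φ (-x) = Φ x
  zero : Φ 0 = 0
  tendsto : Tendsto Φ atTop atTop

/-- The Mulholland condition: `Φ` is continuous, strictly increasing on `[0, ∞)`, and `log (Φ x)`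
is a convex function of `log x` (for `x > 0`). -/
structure MulhollandCondition (Φ : ℝ → ℝ) : Prop where
  continuous : Continuous Φ
  strictMono : StrictMonoOn Φ (Set.Ici 0)
  log_convex : ConvexOn ℝ Set.univ fun s : ℝ => Real.log (Φ (Real.exp s))

/-- `χ` is the characteristic function of `Φ` : `Φ x = |x| exp (χ (log |x|))` (for `x = 0` both
sides vanish when `Φ 0 = 0`). -/
def IsCharacteristicFunction (χ Φ : ℝ → ℝ) : Prop :=
  ∀ x : ℝ, Φ x = |x| * Real.exp (χ (Real.log |x|))

/-- The line `s ↦ m * s + c` is an asymptote (at `+∞`) of `χ`. -/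
def IsLinearAsymptote (χ : ℝ → ℝ) (m c : ℝ) : Prop :=
  Tendsto (fun s => χ s - (m * s + c)) atTop (𝓝 0)

/-- Young functions with the Mulholland condition. -/
structure MulhollandYoung where
  toFun : ℝ → ℝ
  isYoung : IsYoungFunction toFun
  mulholland : MulhollandCondition toFun

namespace MulhollandYoung

instance : CoeFun MulhollandYoung (fun _ => ℝ → ℝ) := ⟨toFun⟩

variable (Ω : MulhollandYoung)

/-- The inverse of the bijection `Ω : [0, ∞) → [0, ∞)`. -/
noncomputable def inv (s : ℝ) : ℝ := Function.invFunOn Ω (Set.Ici 0) s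

theorem surj {s : ℝ} (hs : 0 ≤ s) : ∃ t ∈ Set.Ici (0 : ℝ), Ω t = s := by
  obtain ⟨b, hb, hb0⟩ := ((Ω.isYoung.tendsto.eventually_ge_atTop s).and
    (eventually_ge_atTop (0 : ℝ))).exists
  have h := intermediate_value_Icc hb0 Ω.mulholland.continuous.continuousOn
  obtain ⟨t, ht, hts⟩ := h ⟨Ω.isYoung.zero.le.trans hs, hb⟩
  exact ⟨t, ht.1, hts⟩

theorem inv_nonneg {s : ℝ} (hs : 0 ≤ s) : 0 ≤ Ω.inv s :=
  Function.invFunOn_mem (Ω.surj hs)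

theorem apply_inv {s : ℝ} (hs : 0 ≤ s) : Ω (Ω.inv s) = s :=
  Function.invFunOn_eq (Ω.surj hs)

theorem inv_apply {t : ℝ} (ht : 0 ≤ t) : Ω.inv (Ω t) = t :=
  Ω.mulholland.strictMono.injOn.leftInvOn_invFunOn ht

theorem le_iff {s t : ℝ} (hs : 0 ≤ s) (ht : 0 ≤ t) : Ω s ≤ Ω t ↔ s ≤ t :=
  Ω.mulholland.strictMono.le_iff_le hs ht

theorem pos {t : ℝ} (ht : 0 < t) : 0 < Ω t := by
  have := Ω.mulholland.strictMono (Set.mem_Ici.2 le_rfl) ht.le ht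
  rwa [Ω.isYoung.zero] at this

theorem mul_le_mul_aux {s u w : ℝ} (hs : 0 ≤ s) (hs1 : s ≤ 1) (hu : 0 < u) (huw : u ≤ w) :
    Ω (s * w) * Ω u ≤ Ω (s * u) * Ω w := by
  rcases hs.eq_or_lt with rfl | hs
  · simp [Ω.isYoung.zero]
  have hw : 0 < w := hu.trans_le huw
  rcases (show s * u ≤ w by nlinarith).eq_or_lt with h | h
  · have h1 : s * w = u := by nlinarith
    have h2 : u = w := by nlinarith
    rw [h1, h, h2]
  have hsu : 0 < s * u := by positivity
  have hsw : 0 < s * w := by positivity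
  set A := Real.log (s * u) with hA
  set D := Real.log w with hD
  have hAD : A < D := Real.log_lt_log hsu h
  have hAB : A ≤ Real.log u := Real.log_le_log hsu (by nlinarith)
  have hBD : Real.log u ≤ D := Real.log_le_log hu huw
  have hsum : Real.log u + Real.log (s * w) = A + D := by
    rw [hA, hD, Real.log_mul hs.ne' hw.ne', Real.log_mul hs.ne' hu.ne']; ring
  have hne : D - A ≠ 0 := by linarith
  set θ := (Real.log u - A) / (D - A) with hθ
  have h0 : 0 ≤ θ := div_nonneg (by linarith) (by linarith)
  have h1 : θ ≤ 1 := (div_le_one (by linarith)).2 (by linarith)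
  have hB : (1 - θ) * A + θ * D = Real.log u := by
    have : θ * (D - A) = Real.log u - A := div_mul_cancel₀ _ hne
    linarith
  have hC : θ * A + (1 - θ) * D = Real.log (s * w) := by linarith
  have c1 := Ω.mulholland.log_convex.2 (Set.mem_univ A) (Set.mem_univ D)
    (sub_nonneg.2 h1) h0 (by ring)
  have c2 := Ω.mulholland.log_convex.2 (Set.mem_univ A) (Set.mem_univ D)
    h0 (sub_nonneg.2 h1) (by ring)
  simp only [smul_eq_mul] at c1 c2
  rw [hB] at c1
  rw [hC] at c2
  rw [hA, hD] at c1 c2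
  simp only [Real.exp_log hu, Real.exp_log hw, Real.exp_log hsu, Real.exp_log hsw] at c1 c2
  rw [← Real.log_le_log_iff (mul_pos (Ω.pos hsw) (Ω.pos hu)) (mul_pos (Ω.pos hsu) (Ω.pos hw)),
    Real.log_mul (Ω.pos hsw).ne' (Ω.pos hu).ne', Real.log_mul (Ω.pos hsu).ne' (Ω.pos hw).ne']
  linarith

/-- The function `(a, b) ↦ Ω⁻¹ (Ω a + Ω b)`. -/
noncomputable def comb (a b : ℝ) : ℝ := Ω.inv (Ω a + Ω b)

theorem comb_nonneg (a b : ℝ) : 0 ≤ Ω.comb a b :=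
  Ω.inv_nonneg (add_nonneg (Ω.isYoung.nonneg a) (Ω.isYoung.nonneg b))

theorem apply_comb (a b : ℝ) : Ω (Ω.comb a b) = Ω a + Ω b :=
  Ω.apply_inv (add_nonneg (Ω.isYoung.nonneg a) (Ω.isYoung.nonneg b))

theorem le_comb_left {a : ℝ} (ha : 0 ≤ a) (b : ℝ) : a ≤ Ω.comb a b := by
  rw [← Ω.le_iff ha (Ω.comb_nonneg a b), apply_comb]
  linarith [Ω.isYoung.nonneg b]

theorem le_comb_right (a : ℝ) {b : ℝ} (hb : 0 ≤ b) : b ≤ Ω.comb a b := by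
  rw [← Ω.le_iff hb (Ω.comb_nonneg a b), apply_comb]
  linarith [Ω.isYoung.nonneg a]

theorem comb_zero_right {a : ℝ} (ha : 0 ≤ a) : Ω.comb a 0 = a := by
  rw [comb, Ω.isYoung.zero, add_zero, Ω.inv_apply ha]

theorem comb_zero_left {b : ℝ} (hb : 0 ≤ b) : Ω.comb 0 b = b := by
  rw [comb, Ω.isYoung.zero, zero_add, Ω.inv_apply hb]

theorem comb_mono {a b a' b' : ℝ} (ha : 0 ≤ a) (hb : 0 ≤ b) (h : a ≤ a') (h' : b ≤ b') :
    Ω.comb a b ≤ Ω.comb a' b' := by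
  rw [← Ω.le_iff (Ω.comb_nonneg _ _) (Ω.comb_nonneg _ _), apply_comb, apply_comb]
  exact add_le_add ((Ω.le_iff ha (ha.trans h)).2 h) ((Ω.le_iff hb (hb.trans h')).2 h')

theorem add_div_aux {x y u v : ℝ} (hx : 0 ≤ x) (hy : 0 ≤ y) (hu : 0 < u) (hv : 0 < v)
    (hxu : x ≤ u) (hyv : y ≤ v) :
    Ω (x + y) ≤ Ω (u + v) * (u / (u + v) * (Ω x / Ω u) + v / (u + v) * (Ω y / Ω v)) := by
  have hw : 0 < u + v := add_pos hu hv
  have c := Ω.isYoung.convex.2 (Set.mem_univ (x / u * (u + v))) (Set.mem_univ (y / v * (u + v)))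
    (div_nonneg hu.le hw.le) (div_nonneg hv.le hw.le) (by field_simp)
  simp only [smul_eq_mul] at c
  have e : u / (u + v) * (x / u * (u + v)) + v / (u + v) * (y / v * (u + v)) = x + y := by
    field_simp
  rw [e] at c
  have h1 := Ω.mul_le_mul_aux (div_nonneg hx hu.le) ((div_le_one hu).2 hxu) hu
    (le_add_of_nonneg_right hv.le : u ≤ u + v)
  have h2 := Ω.mul_le_mul_aux (div_nonneg hy hv.le) ((div_le_one hv).2 hyv) hv
    (le_add_of_nonneg_left hu.le : v ≤ u + v)
  rw [div_mul_cancel₀ _ hu.ne'] at h1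
  rw [div_mul_cancel₀ _ hv.ne'] at h2
  rw [← le_div_iff₀ (Ω.pos hu)] at h1
  rw [← le_div_iff₀ (Ω.pos hv)] at h2
  have k1 := mul_le_mul_of_nonneg_left h1 (div_nonneg hu.le hw.le)
  have k2 := mul_le_mul_of_nonneg_left h2 (div_nonneg hv.le hw.le)
  refine (c.trans (add_le_add k1 k2)).trans (le_of_eq ?_)
  ring

/-- Mulholland's inequality for two summands; it makes `d_Ω` a metric. -/
theorem comb_add_le {a b c d : ℝ} (ha : 0 ≤ a) (hb : 0 ≤ b) (hc : 0 ≤ c) (hd : 0 ≤ d) :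
    Ω.comb (a + c) (b + d) ≤ Ω.comb a b + Ω.comb c d := by
  have hu := Ω.comb_nonneg a b
  have hv := Ω.comb_nonneg c d
  have au := Ω.le_comb_left ha b
  have bu := Ω.le_comb_right a hb
  have cv := Ω.le_comb_left hc d
  have dv := Ω.le_comb_right c hd
  have eu := Ω.apply_comb a b
  have ev := Ω.apply_comb c d
  rcases hu.eq_or_lt with h | hu
  · rw [← h] at au bu
    rw [le_antisymm au ha, le_antisymm bu hb]
    simp only [zero_add]
    exact le_add_of_nonneg_left (Ω.comb_nonneg 0 0)
  rcases hv.eq_or_lt with h | hv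
  · rw [← h] at cv dv
    rw [le_antisymm cv hc, le_antisymm dv hd]
    simp only [add_zero]
    exact le_add_of_nonneg_right (Ω.comb_nonneg 0 0)
  rw [← Ω.le_iff (Ω.comb_nonneg _ _) (by positivity), apply_comb]
  set u := Ω.comb a b
  set v := Ω.comb c d
  have h1 := Ω.add_div_aux ha hc hu hv au cv
  have h2 := Ω.add_div_aux hb hd hu hv bu dv
  have pu := Ω.pos hu
  have pv := Ω.pos hv
  refine (add_le_add h1 h2).trans (le_of_eq ?_)
  have e1 : Ω a / Ω u + Ω b / Ω u = 1 := by rw [← add_div, ← eu, div_self pu.ne']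
  have e2 : Ω c / Ω v + Ω d / Ω v = 1 := by rw [← add_div, ← ev, div_self pv.ne']
  have e3 : u / (u + v) + v / (u + v) = 1 := by
    rw [← add_div, div_self (add_pos hu hv).ne']
  linear_combination (Ω (u + v)) * (u / (u + v)) * e1 + (Ω (u + v)) * (v / (u + v)) * e2
    + Ω (u + v) * e3

end MulhollandYoung

/-- The direct sum `X₁ ⊕ X₂`, to be equipped with the F-norm
`‖(x₁, x₂)‖ = Ω⁻¹ (Ω ‖x₁‖ + Ω ‖x₂‖)` and the metric `d_Ω`. -/
@[ext]
structure YoungSum (Ω : MulhollandYoung) (X₁ X₂ : Type*) where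
  fst : X₁
  snd : X₂

namespace YoungSum

/-- The underlying vector space is `X₁ × X₂`. -/
def equivProd (Ω : MulhollandYoung) (X₁ X₂ : Type*) : YoungSum Ω X₁ X₂ ≃ X₁ × X₂ where
  toFun x := (x.fst, x.snd)
  invFun x := ⟨x.1, x.2⟩
  left_inv _ := rfl
  right_inv _ := rfl

section

variable (Ω : MulhollandYoung) (X₁ X₂ : Type*) [NormedAddCommGroup X₁] [NormedAddCommGroup X₂]

instance : AddCommGroup (YoungSum Ω X₁ X₂) := (equivProd Ω X₁ X₂).addCommGroup

instance (𝕜 : Type*) [RCLike 𝕜] [NormedSpace 𝕜 X₁] [NormedSpace 𝕜 X₂] :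
    Module 𝕜 (YoungSum Ω X₁ X₂) := (equivProd Ω X₁ X₂).module 𝕜

/-- The F-norm `‖(x₁, x₂)‖ = Ω⁻¹ (Ω ‖x₁‖ + Ω ‖x₂‖)` (not homogeneous in general). -/
noncomputable def fnorm : AddGroupNorm (YoungSum Ω X₁ X₂) where
  toFun x := Ω.inv (Ω ‖x.fst‖ + Ω ‖x.snd‖)
  map_zero' := by
    change Ω.comb ‖(0 : X₁)‖ ‖(0 : X₂)‖ = 0
    rw [norm_zero, norm_zero, Ω.comb_zero_left le_rfl]
  add_le' x y := (Ω.comb_mono (norm_nonneg _) (norm_nonneg _) (norm_add_le x.fst y.fst)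
    (norm_add_le x.snd y.snd)).trans
      (Ω.comb_add_le (norm_nonneg _) (norm_nonneg _) (norm_nonneg _) (norm_nonneg _))
  neg' x := by
    change Ω.comb ‖-x.fst‖ ‖-x.snd‖ = Ω.comb ‖x.fst‖ ‖x.snd‖
    rw [norm_neg, norm_neg]
  eq_zero_of_map_eq_zero' x hx := by
    change Ω.comb ‖x.fst‖ ‖x.snd‖ = 0 at hx
    have h1 := Ω.le_comb_left (norm_nonneg x.fst) ‖x.snd‖
    have h2 := Ω.le_comb_right ‖x.fst‖ (norm_nonneg x.snd)
    rw [hx] at h1 h2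
    exact YoungSum.ext (norm_le_zero_iff.1 h1) (norm_le_zero_iff.1 h2)

/-- The metric space `(X₁ ⊕ X₂, d_Ω)`, with its topology; `NormedAddCommGroup` does not include
any homogeneity of the norm under scalar multiplication. -/
noncomputable instance : NormedAddCommGroup (YoungSum Ω X₁ X₂) :=
  (fnorm Ω X₁ X₂).toNormedAddCommGroup

end

variable {Ω : MulhollandYoung} {X₁ X₂ : Type*} [NormedAddCommGroup X₁] [NormedAddCommGroup X₂]

@[simp] theorem add_fst (x y : YoungSum Ω X₁ X₂) : (x + y).fst = x.fst + y.fst := rfl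
@[simp] theorem add_snd (x y : YoungSum Ω X₁ X₂) : (x + y).snd = x.snd + y.snd := rfl
@[simp] theorem sub_fst (x y : YoungSum Ω X₁ X₂) : (x - y).fst = x.fst - y.fst := rfl
@[simp] theorem sub_snd (x y : YoungSum Ω X₁ X₂) : (x - y).snd = x.snd - y.snd := rfl

section smul

variable {𝕜 : Type*} [RCLike 𝕜] [NormedSpace 𝕜 X₁] [NormedSpace 𝕜 X₂]

@[simp] theorem smul_fst (c : 𝕜) (x : YoungSum Ω X₁ X₂) : (c • x).fst = c • x.fst := rfl
@[simp] theorem smul_snd (c : 𝕜) (x : YoungSum Ω X₁ X₂) : (c • x).snd = c • x.snd := rfl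

end smul

theorem norm_eq (x : YoungSum Ω X₁ X₂) : ‖x‖ = Ω.inv (Ω ‖x.fst‖ + Ω ‖x.snd‖) := rfl

/-- The metric is `d_Ω`. -/
theorem dist_eq (x y : YoungSum Ω X₁ X₂) :
    dist x y = Ω.inv (Ω ‖x.fst - y.fst‖ + Ω ‖x.snd - y.snd‖) := by
  rw [dist_eq_norm, norm_eq, sub_fst, sub_snd]

theorem norm_prod_le (x : YoungSum Ω X₁ X₂) : ‖(x.fst, x.snd)‖ ≤ ‖x‖ :=
  max_le (Ω.le_comb_left (norm_nonneg x.fst) ‖x.snd‖)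
    (Ω.le_comb_right ‖x.fst‖ (norm_nonneg x.snd))

theorem norm_le_prod (x : YoungSum Ω X₁ X₂) : ‖x‖ ≤ 2 * ‖(x.fst, x.snd)‖ := by
  have h := Ω.comb_add_le (norm_nonneg x.fst) le_rfl le_rfl (norm_nonneg x.snd)
  rw [add_zero, zero_add, Ω.comb_zero_right (norm_nonneg _),
    Ω.comb_zero_left (norm_nonneg _)] at h
  have h1 : ‖x.fst‖ ≤ ‖(x.fst, x.snd)‖ := le_max_left _ _
  have h2 : ‖x.snd‖ ≤ ‖(x.fst, x.snd)‖ := le_max_right _ _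
  exact h.trans (by linarith)

/-- The identity `(X₁ ⊕ X₂, d_Ω) → X₁ × X₂` is a uniform isomorphism. -/
def uniformEquivProd : YoungSum Ω X₁ X₂ ≃ᵤ X₁ × X₂ where
  toEquiv := equivProd Ω X₁ X₂
  uniformContinuous_toFun := by
    refine (LipschitzWith.of_dist_le_mul (K := 1) fun x y => ?_).uniformContinuous
    rw [dist_eq_norm, dist_eq_norm, NNReal.coe_one, one_mul]
    exact norm_prod_le (x - y)
  uniformContinuous_invFun := by
    refine (LipschitzWith.of_dist_le_mul (K := 2) fun x y => ?_).uniformContinuous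
    rw [dist_eq_norm, dist_eq_norm]
    exact norm_le_prod (Ω := Ω) ⟨x.1 - y.1, x.2 - y.2⟩

/-- Together with the translation invariant metric structure above, the next two instances say that
`(X₁ ⊕ X₂, d_Ω)` is an F-space when `X₁` and `X₂` are Banach spaces. -/
instance [CompleteSpace X₁] [CompleteSpace X₂] : CompleteSpace (YoungSum Ω X₁ X₂) :=
  (uniformEquivProd (Ω := Ω) (X₁ := X₁) (X₂ := X₂)).completeSpace_iff.2 inferInstance

instance (𝕜 : Type*) [RCLike 𝕜] [NormedSpace 𝕜 X₁] [NormedSpace 𝕜 X₂] :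
    ContinuousSMul 𝕜 (YoungSum Ω X₁ X₂) where
  continuous_smul := by
    let e := (uniformEquivProd (Ω := Ω) (X₁ := X₁) (X₂ := X₂)).toHomeomorph
    have h : Continuous fun z : 𝕜 × YoungSum Ω X₁ X₂ => e.symm (z.1 • e z.2) := by fun_prop
    exact h

end YoungSum

/-! Since `log (Ω (exp s)) = s + χ s` is convex, `χ - χ_p` is convex with limit `0` at `+∞`, hence
nonincreasing: `Ω x / x ^ p` decreases. So the F-norm dominates the `ℓ^p` norm
(`rpow_add_rpow_le_comb_rpow`), and Hölder makes `‖f‖_q` an admissible constant. Conversely, `Ω (t *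
a) / t ^ p → a ^ p / p`, so on large dilates the F-norm is asymptotically the `ℓ^p` norm.
Functionals are homogeneous, so a bound by the F-norm implies the same bound by the `ℓ^p` norm
(`add_le_mul_of_le_mul_comb`), whose best constant is `‖f‖_q`. Topologically nothing changes: the
F-norm lies between the max norm and twice it, so the strong dual is that of `X₁ × X₂`. -/

/-- A convex function on `ℝ` with a finite limit at `+∞` is antitone. -/
theorem ConvexOn.antitone_of_tendsto_atTop {h : ℝ → ℝ} {l : ℝ} (hc : ConvexOn ℝ Set.univ h)
    (hl : Tendsto h atTop (𝓝 l)) : Antitone h := by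
  intro s t hst
  rcases hst.eq_or_lt with rfl | hst
  · exact le_rfl
  -- Secant slopes from `s` increase by convexity and tend to `0`, so none is positive.
  have hlim : Tendsto (fun r => (h r - h s) / (r - s)) atTop (𝓝 0) :=
    (hl.sub_const (h s)).div_atTop (tendsto_atTop_add_const_right _ (-s) tendsto_id)
  have hle : (h t - h s) / (t - s) ≤ 0 := by
    refine ge_of_tendsto hlim ?_
    filter_upwards [eventually_ge_atTop t] with r hr
    exact hc.secant_mono (Set.mem_univ s) (Set.mem_univ t) (Set.mem_univ r) hst.ne'
      (hst.trans_le hr).ne' hr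
  have hpos : 0 < t - s := sub_pos.2 hst
  have := (div_le_iff₀ hpos).1 hle
  linarith

/-! ### Comparison of the F-norm with the `ℓ^p` norm -/

namespace MulhollandYoung

variable {Ω : MulhollandYoung} {χ : ℝ → ℝ} {p : ℝ}

theorem log_apply_exp (hχ : IsCharacteristicFunction χ Ω) (s : ℝ) :
    Real.log (Ω (Real.exp s)) = s + χ s := by
  rw [hχ, abs_of_pos (Real.exp_pos s), Real.log_exp, ← Real.exp_add, Real.log_exp]

theorem antitone_sub_asymptote (hχ : IsCharacteristicFunction χ Ω)
    (hasymp : IsLinearAsymptote χ (p - 1) (-Real.log p)) :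
    Antitone fun s => χ s - ((p - 1) * s + -Real.log p) := by
  refine ConvexOn.antitone_of_tendsto_atTop ?_ hasymp
  have hc := Ω.mulholland.log_convex
  simp only [log_apply_exp hχ] at hc
  refine ⟨convex_univ, fun x hx y hy a b ha hb hab => ?_⟩
  have := hc.2 hx hy ha hb hab
  simp only [smul_eq_mul] at this ⊢
  linear_combination this - Real.log p * hab

/-- `Ω x / x ^ p` is nonincreasing for `x > 0`. -/
theorem apply_mul_rpow_le (hχ : IsCharacteristicFunction χ Ω)
    (hasymp : IsLinearAsymptote χ (p - 1) (-Real.log p)) {a u : ℝ} (ha : 0 < a) (hau : a ≤ u) :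
    Ω u * a ^ p ≤ Ω a * u ^ p := by
  have hu : 0 < u := ha.trans_le hau
  have h := antitone_sub_asymptote hχ hasymp (Real.log_le_log ha hau)
  have ea := log_apply_exp hχ (Real.log a)
  have eu := log_apply_exp hχ (Real.log u)
  rw [Real.exp_log ha] at ea
  rw [Real.exp_log hu] at eu
  have hpa := Real.rpow_pos_of_pos ha p
  have hpu := Real.rpow_pos_of_pos hu p
  rw [← Real.log_le_log_iff (mul_pos (Ω.pos hu) hpa) (mul_pos (Ω.pos ha) hpu),
    Real.log_mul (Ω.pos hu).ne' hpa.ne', Real.log_mul (Ω.pos ha).ne' hpu.ne',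
    Real.log_rpow ha, Real.log_rpow hu, ea, eu]
  simp only at h
  linarith

/-- With `u = Ω.comb a b`, monotonicity of `Ω x / x ^ p` gives `(c / u) ^ p ≤ Ω c / Ω u` for `c = a,
b`; the right sides add up to `1`. -/
theorem rpow_add_rpow_le_comb_rpow (hχ : IsCharacteristicFunction χ Ω) (hp : 1 ≤ p)
    (hasymp : IsLinearAsymptote χ (p - 1) (-Real.log p)) {a b : ℝ} (ha : 0 ≤ a) (hb : 0 ≤ b) :
    a ^ p + b ^ p ≤ Ω.comb a b ^ p := by
  have key : ∀ {c}, 0 ≤ c → c ≤ Ω.comb a b →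
      Ω (Ω.comb a b) * c ^ p ≤ Ω c * Ω.comb a b ^ p := by
    intro c hc hcu
    rcases hc.eq_or_lt with rfl | hc
    · simp [Ω.isYoung.zero, Real.zero_rpow (by linarith : p ≠ 0)]
    · exact apply_mul_rpow_le hχ hasymp hc hcu
  have hau := Ω.le_comb_left ha b
  have hbu := Ω.le_comb_right a hb
  rcases (Ω.comb_nonneg a b).eq_or_lt with h0 | h0
  · rw [← h0] at hau hbu ⊢
    rw [le_antisymm hau ha, le_antisymm hbu hb]
    simp [Real.zero_rpow (by linarith : p ≠ 0)]
  · refine le_of_mul_le_mul_left ?_ (Ω.pos h0)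
    calc _ = Ω (Ω.comb a b) * a ^ p + Ω (Ω.comb a b) * b ^ p := mul_add _ _ _
      _ ≤ Ω a * Ω.comb a b ^ p + Ω b * Ω.comb a b ^ p := add_le_add (key ha hau) (key hb hbu)
      _ = _ := by rw [Ω.apply_comb]; ring

/-- The quotient equals `a ^ p / p` times `exp (χ - χ_p)` at `log (t * a)`; the intercept `-log p`
produces the factor `1 / p`. -/
theorem tendsto_apply_mul_div_rpow (hχ : IsCharacteristicFunction χ Ω) (hp : 1 ≤ p)
    (hasymp : IsLinearAsymptote χ (p - 1) (-Real.log p)) {a : ℝ} (ha : 0 ≤ a) :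
    Tendsto (fun t => Ω (t * a) / t ^ p) atTop (𝓝 (a ^ p / p)) := by
  have hp0 : 0 < p := by linarith
  rcases ha.eq_or_lt with rfl | ha
  · simp [Ω.isYoung.zero, Real.zero_rpow hp0.ne']
  have h1 : Tendsto (fun t => Real.log (t * a)) atTop atTop :=
    Real.tendsto_log_atTop.comp (tendsto_id.atTop_mul_const ha)
  have h2 := ((Real.continuous_exp.tendsto 0).comp (hasymp.comp h1)).const_mul (a ^ p / p)
  rw [Real.exp_zero, mul_one] at h2
  refine h2.congr' ?_
  filter_upwards [eventually_gt_atTop 0] with t ht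
  have hta : 0 < t * a := mul_pos ht ha
  have e : Real.exp ((p - 1) * Real.log (t * a)) = (t ^ p * a ^ p) / (t * a) := by
    rw [← Real.mul_rpow ht.le ha.le, mul_comm, ← Real.rpow_def_of_pos hta, Real.rpow_sub_one hta.ne']
  have hpt := Real.rpow_pos_of_pos ht p
  have hpa := Real.rpow_pos_of_pos ha p
  simp only [Function.comp_apply]
  rw [hχ (t * a), abs_of_pos hta, Real.exp_sub, Real.exp_add, e, Real.exp_neg, Real.exp_log hp0]
  field_simp

theorem eventually_comb_mul_le (hχ : IsCharacteristicFunction χ Ω) (hp : 1 ≤ p)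
    (hasymp : IsLinearAsymptote χ (p - 1) (-Real.log p)) {a b K : ℝ} (ha : 0 ≤ a) (hb : 0 ≤ b)
    (hK : 0 ≤ K) (h : a ^ p + b ^ p < K ^ p) :
    ∀ᶠ t in atTop, Ω.comb (t * a) (t * b) ≤ t * K := by
  have hlt : a ^ p / p + b ^ p / p < K ^ p / p := by
    rw [← add_div]
    exact div_lt_div_of_pos_right h (by linarith)
  filter_upwards [((tendsto_apply_mul_div_rpow hχ hp hasymp ha).add
    (tendsto_apply_mul_div_rpow hχ hp hasymp hb)).eventually_lt
    (tendsto_apply_mul_div_rpow hχ hp hasymp hK) hlt, eventually_gt_atTop 0] with t hlt' ht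
  rw [← add_div, div_lt_div_iff_of_pos_right (Real.rpow_pos_of_pos ht p)] at hlt'
  rw [← Ω.le_iff (Ω.comb_nonneg _ _) (by positivity), apply_comb]
  exact hlt'.le

/-- Apply `h` to a large dilate `(t * a, t * b)`, where `Ω.comb` is at most `t * K`, and cancel `t`.
-/
theorem add_le_mul_of_le_mul_comb (hχ : IsCharacteristicFunction χ Ω) (hp : 1 ≤ p)
    (hasymp : IsLinearAsymptote χ (p - 1) (-Real.log p)) {c d C : ℝ} (hC : 0 ≤ C)
    (h : ∀ a b, 0 ≤ a → 0 ≤ b → c * a + d * b ≤ C * Ω.comb a b)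
    {a b K : ℝ} (ha : 0 ≤ a) (hb : 0 ≤ b) (hK : 0 ≤ K) (hlt : a ^ p + b ^ p < K ^ p) :
    c * a + d * b ≤ C * K := by
  obtain ⟨t, ht, ht0⟩ := ((eventually_comb_mul_le hχ hp hasymp ha hb hK hlt).and
    (eventually_gt_atTop 0)).exists
  have h1 := h (t * a) (t * b) (by positivity) (by positivity)
  have h2 := mul_le_mul_of_nonneg_left ht hC
  refine le_of_mul_le_mul_left ?_ ht0
  linarith

end MulhollandYoung

/-! ### Hölder duality on two summands -/

section Conjugate

variable {p : ℝ} {q : ENNReal}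

theorem ENNReal.eq_top_or_holderConjugate (hp : 1 ≤ p)
    (hpq : (ENNReal.ofReal p)⁻¹ + q⁻¹ = 1) :
    p = 1 ∧ q = ⊤ ∨ 1 < p ∧ 0 < q.toReal ∧ p.HolderConjugate q.toReal := by
  have hp0 : 0 < p := by linarith
  rcases hp.eq_or_lt with rfl | hp1
  · left
    refine ⟨rfl, ?_⟩
    rw [ENNReal.ofReal_one, inv_one] at hpq
    exact ENNReal.inv_eq_zero.1 ((ENNReal.add_right_inj ENNReal.one_ne_top).1 (by simpa using hpq))
  · right
    have hne : q⁻¹ ≠ ⊤ := fun h => by simp [h] at hpq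
    have h := congrArg ENNReal.toReal hpq
    rw [ENNReal.toReal_add (by simp [hp0]) hne, ENNReal.toReal_inv, ENNReal.toReal_inv,
      ENNReal.toReal_ofReal hp0.le, ENNReal.toReal_one] at h
    have hc : p.HolderConjugate q.toReal := Real.holderConjugate_iff.2 ⟨hp1, h⟩
    exact ⟨hp1, hc.symm.pos, hc⟩

variable [Fact (1 ≤ q)] {E F : Type*} [SeminormedAddCommGroup E] [SeminormedAddCommGroup F]

/-- Hölder's inequality against the norm of `WithLp q (E × F)`. -/
theorem WithLp.add_mul_le_prod_norm_mul (hp : 1 ≤ p) (hpq : (ENNReal.ofReal p)⁻¹ + q⁻¹ = 1)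
    (f : WithLp q (E × F)) {a b K : ℝ} (ha : 0 ≤ a) (hb : 0 ≤ b) (hK : 0 ≤ K)
    (h : a ^ p + b ^ p ≤ K ^ p) : ‖f.fst‖ * a + ‖f.snd‖ * b ≤ ‖f‖ * K := by
  rcases ENNReal.eq_top_or_holderConjugate hp hpq with ⟨rfl, rfl⟩ | ⟨hp1, hq, hc⟩
  · simp only [Real.rpow_one] at h
    rw [WithLp.prod_norm_eq_sup]
    have h1 : ‖f.fst‖ ≤ ‖f.fst‖ ⊔ ‖f.snd‖ := le_sup_left
    have h2 : ‖f.snd‖ ≤ ‖f.fst‖ ⊔ ‖f.snd‖ := le_sup_right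
    calc _ ≤ (‖f.fst‖ ⊔ ‖f.snd‖) * a + (‖f.fst‖ ⊔ ‖f.snd‖) * b := by gcongr
      _ = (‖f.fst‖ ⊔ ‖f.snd‖) * (a + b) := by ring
      _ ≤ _ := mul_le_mul_of_nonneg_left h ((norm_nonneg _).trans h1)
  · rw [WithLp.prod_norm_eq_add hq]
    have hH := Real.inner_le_Lp_mul_Lq_of_nonneg (Finset.univ : Finset (Fin 2)) hc.symm
      (f := ![‖f.fst‖, ‖f.snd‖]) (g := ![a, b])
      (by intro i _; fin_cases i <;> simp) (by intro i _; fin_cases i <;> simpa)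
    simp only [Fin.sum_univ_two, Matrix.cons_val_zero, Matrix.cons_val_one] at hH
    refine hH.trans (mul_le_mul_of_nonneg_left ?_ (by positivity))
    rw [one_div]
    exact (Real.rpow_inv_le_iff_of_pos (by positivity) hK (by linarith)).2 h

/-- The norm of `WithLp q (E × F)` is the best constant in Hölder's inequality. -/
theorem WithLp.prod_norm_le_of_forall_add_mul_le (hp : 1 ≤ p)
    (hpq : (ENNReal.ofReal p)⁻¹ + q⁻¹ = 1) (f : WithLp q (E × F)) {C : ℝ}
    (h : ∀ a b K : ℝ, 0 ≤ a → 0 ≤ b → 0 ≤ K → a ^ p + b ^ p < K ^ p →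
      ‖f.fst‖ * a + ‖f.snd‖ * b ≤ C * K) : ‖f‖ ≤ C := by
  have h' : ∀ a b K : ℝ, 0 ≤ a → 0 ≤ b → 0 ≤ K → a ^ p + b ^ p ≤ K ^ p →
      ‖f.fst‖ * a + ‖f.snd‖ * b ≤ C * K := by
    intro a b K ha hb hK hle
    -- The strict hypothesis holds for every `L > K`; let `L` decrease to `K`.
    have ht : Tendsto (fun K => C * K) (𝓝[>] K) (𝓝 (C * K)) :=
      ((continuous_const_mul C).tendsto K).mono_left nhdsWithin_le_nhds
    refine ge_of_tendsto ht ?_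
    filter_upwards [self_mem_nhdsWithin] with L hL
    exact h a b L ha hb (hK.trans (le_of_lt hL))
      (hle.trans_lt (Real.rpow_lt_rpow hK hL (by linarith)))
  rcases ENNReal.eq_top_or_holderConjugate hp hpq with ⟨rfl, rfl⟩ | ⟨hp1, hq, hc⟩
  · rw [WithLp.prod_norm_eq_sup]
    refine sup_le ?_ ?_
    · simpa using h' 1 0 1 zero_le_one le_rfl zero_le_one (by simp)
    · simpa using h' 0 1 1 le_rfl zero_le_one zero_le_one (by simp)
  · rw [WithLp.prod_norm_eq_add hq]
    set r := q.toReal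
    set S := ‖f.fst‖ ^ r + ‖f.snd‖ ^ r with hS
    have hS0 : 0 ≤ S := by positivity
    rcases hS0.eq_or_lt with h0 | h0
    -- For `f = 0` only `0 ≤ C` is needed, and `K = 1` yields it.
    · rw [← h0, Real.zero_rpow (by positivity)]
      simpa using (by positivity : 0 ≤ ‖f.fst‖ * 0 + ‖f.snd‖ * 0).trans
        (h' 0 0 1 le_rfl le_rfl zero_le_one (by simp [Real.zero_rpow (by linarith : p ≠ 0)]))
    have hmul : (r - 1) * p = r := hc.symm.sub_one_mul_conj
    have hpow : ∀ c : ℝ, 0 ≤ c → (c ^ (r - 1)) ^ p = c ^ r := fun c hc' => by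
      rw [← Real.rpow_mul hc', hmul]
    have hself : ∀ c : ℝ, 0 ≤ c → c * c ^ (r - 1) = c ^ r := fun c hc' => by
      rw [← Real.rpow_one_add' hc' (by simp [hq.ne'])]; simp
    have hSp : (S ^ (1 / p)) ^ p = S := by
      rw [← Real.rpow_mul hS0, one_div_mul_cancel (by linarith), Real.rpow_one]
    -- The equality case of Hölder: this choice gives `S ≤ C * S ^ (1 / p)`, and `S = S ^ (1 / r) *
    -- S ^ (1 / p)`.
    have hb := h' (‖f.fst‖ ^ (r - 1)) (‖f.snd‖ ^ (r - 1)) (S ^ (1 / p)) (by positivity)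
      (by positivity) (by positivity)
      (by rw [hpow _ (norm_nonneg _), hpow _ (norm_nonneg _), hSp])
    rw [hself _ (norm_nonneg _), hself _ (norm_nonneg _), ← hS] at hb
    refine le_of_mul_le_mul_right ?_ (Real.rpow_pos_of_pos h0 (1 / p))
    refine le_trans (le_of_eq ?_) hb
    have hsum : 1 / r + 1 / p = 1 := by
      simpa [one_div, add_comm] using hc.inv_add_inv_eq_one
    rw [← Real.rpow_add h0, hsum, Real.rpow_one]

end Conjugate

/-! ### The dual space and reduction to scalars -/

namespace YoungSum

variable {𝕜 : Type*} [RCLike 𝕜] {X₁ X₂ : Type*}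
  [NormedAddCommGroup X₁] [NormedSpace 𝕜 X₁] [NormedAddCommGroup X₂] [NormedSpace 𝕜 X₂]
  {Ω : MulhollandYoung}

variable (𝕜 Ω X₁ X₂) in
/-- The identity `(X₁ ⊕ X₂, d_Ω) → X₁ × X₂` as a continuous linear equivalence. -/
def continuousLinearEquivProd : YoungSum Ω X₁ X₂ ≃L[𝕜] X₁ × X₂ where
  toFun x := (x.fst, x.snd)
  invFun x := ⟨x.1, x.2⟩
  left_inv _ := rfl
  right_inv _ := rfl
  map_add' _ _ := rfl
  map_smul' _ _ := rfl
  continuous_toFun := (uniformEquivProd (Ω := Ω) (X₁ := X₁) (X₂ := X₂)).continuous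
  continuous_invFun := (uniformEquivProd (Ω := Ω) (X₁ := X₁) (X₂ := X₂)).symm.continuous

variable (𝕜 Ω X₁ X₂) in
/-- The continuous linear equivalence `(f₁, f₂) ↦ (x ↦ f₁ x₁ + f₂ x₂)` onto the strong dual. -/
noncomputable def dualEquiv (q : ENNReal) [Fact (1 ≤ q)] :
    WithLp q (StrongDual 𝕜 X₁ × StrongDual 𝕜 X₂) ≃L[𝕜] StrongDual 𝕜 (YoungSum Ω X₁ X₂) :=
  ((WithLp.prodContinuousLinearEquiv q 𝕜 (StrongDual 𝕜 X₁) (StrongDual 𝕜 X₂)).trans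
    (ContinuousLinearMap.coprodEquivL (𝕜 := 𝕜) (S := 𝕜) (E := X₁) (F := X₂) (G := 𝕜))).trans
    ((continuousLinearEquivProd 𝕜 X₁ X₂ Ω).symm.arrowCongr (ContinuousLinearEquiv.refl 𝕜 𝕜))

theorem dualEquiv_apply (q : ENNReal) [Fact (1 ≤ q)]
    (f : WithLp q (StrongDual 𝕜 X₁ × StrongDual 𝕜 X₂)) (x : YoungSum Ω X₁ X₂) :
    dualEquiv 𝕜 X₁ X₂ Ω q f x = f.fst x.fst + f.snd x.snd := rfl

/-- A near-maximizer is rotated by a unimodular scalar, making its value real and nonnegative, so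
that contributions from the two summands cannot cancel. -/
theorem exists_norm_le_apply_eq (f : StrongDual 𝕜 X₁) {r a : ℝ} (hr : r < ‖f‖) (ha : 0 ≤ a) :
    ∃ x, ‖x‖ ≤ a ∧ ∃ s : ℝ, r * a ≤ s ∧ f x = (s : 𝕜) := by
  obtain ⟨x, hx, hfx⟩ := f.exists_lt_apply_of_lt_opNorm hr
  obtain ⟨c, hc, hcf⟩ := RCLike.exists_norm_eq_mul_self (f x)
  refine ⟨((a : 𝕜) * c) • x, ?_, a * ‖f x‖, ?_, ?_⟩
  · rw [norm_smul, norm_mul, hc, RCLike.norm_of_nonneg ha, mul_one]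
    exact mul_le_of_le_one_right ha hx.le
  · rw [mul_comm]
    exact mul_le_mul_of_nonneg_left hfx.le ha
  · rw [map_smul, smul_eq_mul, mul_assoc, ← hcf]
    push_cast
    rfl

theorem opNorm_mul_add_le (f₁ : StrongDual 𝕜 X₁) (f₂ : StrongDual 𝕜 X₂) {C : ℝ} (hC : 0 ≤ C)
    (h : ∀ x : YoungSum Ω X₁ X₂, ‖f₁ x.fst + f₂ x.snd‖ ≤ C * ‖x‖) {a b : ℝ} (ha : 0 ≤ a)
    (hb : 0 ≤ b) : ‖f₁‖ * a + ‖f₂‖ * b ≤ C * Ω.comb a b := by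
  -- The operator norms need not be attained, hence the loss `δ`, sent to `0`.
  have ht : Tendsto (fun δ => (‖f₁‖ - δ) * a + (‖f₂‖ - δ) * b) (𝓝[>] 0)
      (𝓝 (‖f₁‖ * a + ‖f₂‖ * b)) := by
    have hc : Continuous fun δ => (‖f₁‖ - δ) * a + (‖f₂‖ - δ) * b := by fun_prop
    simpa using (hc.tendsto 0).mono_left nhdsWithin_le_nhds
  refine le_of_tendsto ht ?_
  filter_upwards [self_mem_nhdsWithin] with δ hδ
  obtain ⟨x₁, hx₁, s₁, hs₁, e₁⟩ := exists_norm_le_apply_eq f₁ (sub_lt_self _ hδ) ha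
  obtain ⟨x₂, hx₂, s₂, hs₂, e₂⟩ := exists_norm_le_apply_eq f₂ (sub_lt_self _ hδ) hb
  have hx := h ⟨x₁, x₂⟩
  simp only at hx
  rw [e₁, e₂, ← RCLike.ofReal_add, RCLike.norm_ofReal] at hx
  calc _ ≤ s₁ + s₂ := add_le_add hs₁ hs₂
    _ ≤ _ := (le_abs_self _).trans hx
    _ ≤ C * Ω.comb a b := mul_le_mul_of_nonneg_left
      (Ω.comb_mono (norm_nonneg _) (norm_nonneg _) hx₁ hx₂) hC

end YoungSum

theorem mainTheorem8 {𝕜 : Type*} [RCLike 𝕜] {X₁ X₂ : Type*}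
    [NormedAddCommGroup X₁] [NormedSpace 𝕜 X₁] [CompleteSpace X₁]
    [NormedAddCommGroup X₂] [NormedSpace 𝕜 X₂] [CompleteSpace X₂]
    (Ω : MulhollandYoung) (χ : ℝ → ℝ) (hχ : IsCharacteristicFunction χ Ω)
    (p : ℝ) (hp : 1 ≤ p) (hasymp : IsLinearAsymptote χ (p - 1) (-Real.log p))
    (q : ENNReal) [Fact (1 ≤ q)] (hpq : (ENNReal.ofReal p)⁻¹ + q⁻¹ = 1) :
    ∃ T : WithLp q (StrongDual 𝕜 X₁ × StrongDual 𝕜 X₂) ≃L[𝕜] StrongDual 𝕜 (YoungSum Ω X₁ X₂),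
      (∀ f x, T f x = f.fst x.fst + f.snd x.snd) ∧
      ∀ f, IsLeast {C : ℝ | 0 ≤ C ∧ ∀ x, ‖T f x‖ ≤ C * ‖x‖} ‖f‖ := by
  refine ⟨YoungSum.dualEquiv 𝕜 X₁ X₂ Ω q, YoungSum.dualEquiv_apply q, fun f => ⟨⟨norm_nonneg f,
    fun x => ?_⟩, fun C ⟨hC, h⟩ => ?_⟩⟩
  · rw [YoungSum.dualEquiv_apply]
    calc ‖f.fst x.fst + f.snd x.snd‖ ≤ ‖f.fst x.fst‖ + ‖f.snd x.snd‖ := norm_add_le _ _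
      _ ≤ ‖f.fst‖ * ‖x.fst‖ + ‖f.snd‖ * ‖x.snd‖ :=
        add_le_add (f.fst.le_opNorm _) (f.snd.le_opNorm _)
      _ ≤ ‖f‖ * ‖x‖ := WithLp.add_mul_le_prod_norm_mul hp hpq f (norm_nonneg _) (norm_nonneg _)
        (norm_nonneg _)
        (Ω.rpow_add_rpow_le_comb_rpow hχ hp hasymp (norm_nonneg _) (norm_nonneg _))
  · exact WithLp.prod_norm_le_of_forall_add_mul_le hp hpq f fun a b K ha hb hK hlt =>
      MulhollandYoung.add_le_mul_of_le_mul_comb hχ hp hasymp hC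
        (fun a b ha hb => YoungSum.opNorm_mul_add_le f.fst f.snd hC h ha hb) ha hb hK hlt
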